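/- Let $N,M,d,j,k\ge 0$ be integers with $j,k\le N$, and suppose that $M>d$, or that $M\ge d$ and $j=0$. Let $s_{(N^d,j)/(k)}(1^M)$ be the skew Schur polynomial in $M$ variables, all specialized to $1$, indexed by the skew shape whose outer partition is $(N,\dots,N,j)$ ($d$ parts equal to $N$ followed by $j$) and whose inner partition is $(k)$. (As usual, $s_{\mu/\lambda}=\sum_T x^T$ is the sum over the semistandard Young tableaux $T$ of shape $\mu/\lambda$, with $s_{\mu/\lambda}=0$ if $\lambda\not\subseteq\mu$.) Then $$s_{(N^d,j)/(k)}(1^M)=G(N+2)\,\frac{G(M+N+2)}{G(M+1)}\,\frac{G(M-d+1)}{G(M-d+N+2)}\,\frac{G(d+1)}{G(d+N+2)}\cdot\frac{\Gamma(M-d+j+1)}{\Gamma(j+1)}\,\frac{\Gamma(d+k+1)}{\Gamma(k+1)}\sum_{r=\max(j,k)}^{N}\frac{\Gamma(r+1)}{\Gamma(M+r+1)}\binom{M-d+r-k-1}{r-k}\binom{d+r-j-1}{r-j},$$ where $\Gamma$ is the Gamma function, $G$ is the Barnes $G$-function $$G(1+z)=(2\pi)^{z/2}\exp\!\Big(-\tfrac{z+(1+\gamma)z^2}{2}\Big)\prod_{n\ge1}\Big(1+\frac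 zn\Big)^{n}\exp\!\Big(\frac{z^2}{2n}-z\Big),$$ $\gamma$ is the Euler–Mascheroni constant, and $\binom{a}{n}=a(a-1)\cdots(a-n+1)/n!$ for $a\in\mathbb Z$, $n\ge 0$ (so $\binom{-1}{0}=1$). -/

import Mathlib

/-- The partition `(N, …, N, j)` with `d` parts equal to `N` followed by `j ≤ N`
(parts equal to zero contribute no cells). -/
def blockRowShape (N d j : ℕ) (hj : j ≤ N) : YoungDiagram :=
  YoungDiagram.ofRowLens (List.replicate d N ++ [j]) (by
    apply List.Pairwise.sortedGE
    rw [List.pairwise_append]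
    refine ⟨List.pairwise_replicate.2 (Or.inr le_rfl), List.pairwise_singleton _ _, ?_⟩
    intro a ha b hb
    rw [List.eq_of_mem_replicate ha, List.mem_singleton.1 hb]
    exact hj)

/-- The partition `(k)` with a single row of `k` cells. -/
def rowShape (k : ℕ) : YoungDiagram :=
  YoungDiagram.ofRowLens [k] (List.Pairwise.sortedGE (List.pairwise_singleton _ _))

/-- A filling `T` of the cells of the skew diagram `μ / ν` with entries in a linearly ordered
alphabet is semistandard if it is weakly increasing along rows and strictly increasing down
columns. Cells are pairs `(row, column)`. -/
def IsSkewSemistandard {σ : Type*} [LinearOrder σ] (μ ν : YoungDiagram)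
    (T : {c : ℕ × ℕ // c ∈ μ.cells \ ν.cells} → σ) : Prop :=
  (∀ a b, a.1.1 = b.1.1 → a.1.2 < b.1.2 → T a ≤ T b) ∧
  (∀ a b, a.1.2 = b.1.2 → a.1.1 < b.1.1 → T a < T b)

open Classical in
/-- The skew Schur polynomial `s_{μ/ν}` in the variables indexed by the finite ordered set `σ`:
the generating function of the semistandard tableaux of shape `μ / ν`, and zero if `ν` is not
contained in `μ`. -/
noncomputable def skewSchur (σ R : Type*) [Fintype σ] [LinearOrder σ] [CommSemiring R]
    (μ ν : YoungDiagram) : MvPolynomial σ R :=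
  if ν ≤ μ then
    ∑ T : {c : ℕ × ℕ // c ∈ μ.cells \ ν.cells} → σ with IsSkewSemistandard μ ν T,
      ∏ c, MvPolynomial.X (T c)
  else 0

/-- The Barnes `G`-function on the real line, through its Weierstrass product
`G(1 + z) = (2π)^(z/2) exp(-(z + (1 + γ) z²)/2) ∏_{n ≥ 1} (1 + z/n)^n exp(z²/(2n) - z)`,
where `γ` is the Euler–Mascheroni constant; here `z = x - 1`, and the product index is
shifted to start at zero. -/
noncomputable def barnesG (x : ℝ) : ℝ :=
  (2 * Real.pi) ^ ((x - 1) / 2) *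
    Real.exp (-((x - 1) + (1 + Real.eulerMascheroniConstant) * (x - 1) ^ 2) / 2) *
    ∏' n : ℕ, ((1 + (x - 1) / ((n : ℝ) + 1)) ^ (n + 1) *
      Real.exp ((x - 1) ^ 2 / (2 * ((n : ℝ) + 1)) - (x - 1)))

/-!
The skew Schur polynomial at `1^M` counts semistandard tableaux. Reading a tableau entry by entry,
the entries equal to `t` form a horizontal strip, that is, at most one new cell in each column, so
a tableau is the same as a growing sequence of diagrams in which every step adds one cell to each
column of some set (`card_skewSemistandard`). The shifted column heights `b c - c` are then
non-intersecting walks with steps in `{0, 1}`, and there are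
`det (binom(M, b i - i - (a l - l)))` of them (`card_growthPaths`): expand the determinant for
`M + 1` steps by multilinearity in the rows, and note that a first step which breaks the
monotonicity of the heights gives two equal rows. This is the dual Jacobi–Trudi formula at `1^M`.

For the shape `(N^d, j) / (k)` this determinant is a minor of the Toeplitz matrix
`A p q = binom(M, d - p + q)`, `0 ≤ p, q ≤ N`: row `j` and column `k` are deleted. With `e = M - d`
and the diagonal matrices `D_x = diag((x + r)! / r!)`, the Duduchava–Roch factorization
`D_e A D_d = L(d) D_M L(e)ᵀ` holds, where `L(x)` is the unitriangular Toeplitz matrix with symbol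
`(1 + t)^x`; its entries are a form of the Pfaff–Saalschütz summation
(`sum_choose_mul_choose_mul_choose`). Since `L(x) L(-x) = 1`, the factorization yields both `det A`
and `A⁻¹`, hence the adjugate (`adjugate_binomialToeplitz`). The sum over `r` is an entry of the
product `L(-e)ᵀ D_M⁻¹ L(-d)`.

The determinant of `A` is a quotient of products of factorials, which become values of the Barnes
function by `G(n + 1) = ∏_{i < n} i!` (`barnesG_natCast_add_one`). To obtain this from the
Weierstrass product, one passes from `z` to `z + 1`: the quotient of the partial products telescopes
and its limit follows from Stirling's formula and `H_n - log n → γ`.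
-/

/-! ### The Barnes function at positive integers -/

open Filter Topology in
/-- `n! n^z / (n+z)! → 1`. -/
theorem tendsto_factorial_mul_pow_div_factorial_add (z : ℕ) :
    Tendsto (fun n : ℕ => (n.factorial : ℝ) * (n : ℝ) ^ z / ((n + z).factorial : ℝ)) atTop (𝓝 1) := by
  induction z with
  | zero =>
    refine tendsto_const_nhds.congr fun n => ?_
    have : (n.factorial : ℝ) ≠ 0 := by positivity
    simp [this]
  | succ z ih =>
    have h : Tendsto (fun n : ℕ => (n : ℝ) / ((n : ℝ) + ((z : ℝ) + 1))) atTop (𝓝 1) :=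
      tendsto_natCast_div_add_atTop _
    have := ih.mul h
    rw [one_mul] at this
    refine this.congr fun n => ?_
    rw [← add_assoc, ← add_assoc n z 1, Nat.factorial_succ]
    push_cast
    have h1 : ((n + z).factorial : ℝ) ≠ 0 := by positivity
    have h2 : (n : ℝ) + z + 1 ≠ 0 := by positivity
    field_simp
    ring

/-- The factor of index `n` (counted from zero) in the Weierstrass product of `G (1 + z)`. -/
noncomputable def barnesFactor (z : ℝ) (n : ℕ) : ℝ :=
  (1 + z / ((n : ℝ) + 1)) ^ (n + 1) * Real.exp (z ^ 2 / (2 * ((n : ℝ) + 1)) - z)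

/-- The factor in front of the Weierstrass product of `G (1 + z)`. -/
noncomputable def barnesPrefactor (z : ℝ) : ℝ :=
  (2 * Real.pi) ^ (z / 2) *
    Real.exp (-(z + (1 + Real.eulerMascheroniConstant) * z ^ 2) / 2)

theorem barnesG_eq (x : ℝ) :
    barnesG x = barnesPrefactor (x - 1) * ∏' n : ℕ, barnesFactor (x - 1) n := rfl

/-- The quotient of the `n`-th partial Weierstrass products at `z + 1` and at `z`. -/
noncomputable def barnesPartialRatio (z n : ℕ) : ℝ :=
  ((n : ℝ) + z + 1) ^ n * z.factorial / (n + z).factorial *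
    Real.exp (((z : ℝ) + 1 / 2) * (harmonic n : ℝ) - n)

theorem prod_barnesFactor_succ (z n : ℕ) :
    ∏ i ∈ Finset.range n, barnesFactor ((z : ℝ) + 1) i =
      (∏ i ∈ Finset.range n, barnesFactor z i) * barnesPartialRatio z n := by
  induction n with
  | zero =>
    have : (z.factorial : ℝ) ≠ 0 := by positivity
    simp [barnesPartialRatio, this]
  | succ n ih =>
    rw [Finset.prod_range_succ, Finset.prod_range_succ, ih, mul_assoc, mul_assoc]
    congr 1
    have hexp : Real.exp (((z : ℝ) + 1 / 2) * (harmonic n : ℝ) - n) *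
        Real.exp (((z : ℝ) + 1) ^ 2 / (2 * ((n : ℝ) + 1)) - (z + 1)) =
        Real.exp ((z : ℝ) ^ 2 / (2 * ((n : ℝ) + 1)) - z) *
        Real.exp (((z : ℝ) + 1 / 2) * (harmonic (n + 1) : ℝ) - (n + 1 : ℕ)) := by
      rw [← Real.exp_add, ← Real.exp_add, harmonic_succ]
      push_cast
      congr 1
      field_simp
      ring
    have hpow : ((n : ℝ) + z + 1) ^ n * z.factorial / (n + z).factorial *
        (1 + ((z : ℝ) + 1) / ((n : ℝ) + 1)) ^ (n + 1) =
        (1 + (z : ℝ) / ((n : ℝ) + 1)) ^ (n + 1) *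
        (((n + 1 : ℕ) : ℝ) + z + 1) ^ (n + 1) * z.factorial / (n + 1 + z).factorial := by
      rw [show n + 1 + z = (n + z) + 1 by ring, Nat.factorial_succ]
      have h0 : (n : ℝ) + 1 ≠ 0 := by positivity
      have h1 : 1 + ((z : ℝ) + 1) / ((n : ℝ) + 1) = ((n : ℝ) + 1 + z + 1) / (n + 1) := by
        field_simp; ring
      have h2 : 1 + (z : ℝ) / ((n : ℝ) + 1) = ((n : ℝ) + z + 1) / (n + 1) := by
        field_simp; ring
      have h3 : ((n + z).factorial : ℝ) ≠ 0 := by positivity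
      have h4 : (n : ℝ) + z + 1 ≠ 0 := by positivity
      rw [h1, h2, div_pow, div_pow]
      push_cast
      field_simp
      ring
    unfold barnesPartialRatio barnesFactor
    linear_combination
      (Real.exp (((z : ℝ) + 1 / 2) * (harmonic n : ℝ) - n) *
        Real.exp (((z : ℝ) + 1) ^ 2 / (2 * ((n : ℝ) + 1)) - (z + 1))) * hpow +
      ((1 + (z : ℝ) / ((n : ℝ) + 1)) ^ (n + 1) *
        (((n + 1 : ℕ) : ℝ) + z + 1) ^ (n + 1) * z.factorial / (n + 1 + z).factorial) * hexp

open Filter Topology in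
/-- Stirling's formula and `H_n - log n → γ` give the limit of the quotients. -/
theorem tendsto_barnesPartialRatio (z : ℕ) :
    Tendsto (barnesPartialRatio z) atTop
      (𝓝 (z.factorial * Real.exp ((z : ℝ) + 1) *
        Real.exp (((z : ℝ) + 1 / 2) * Real.eulerMascheroniConstant) * (√Real.pi * √2)⁻¹)) := by
  have h1 := Real.tendsto_one_add_div_pow_exp ((z : ℝ) + 1)
  have h2 := tendsto_factorial_mul_pow_div_factorial_add z
  have h3 := (Real.continuous_exp.tendsto _).comp
    (Real.tendsto_harmonic_sub_log.const_mul ((z : ℝ) + 1 / 2))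
  have h4 := ((Stirling.tendsto_stirlingSeq_sqrt_pi).mul_const (√2)).inv₀ (by positivity)
  have h := (((h1.const_mul (z.factorial : ℝ)).mul h2).mul h3).mul h4
  rw [mul_one] at h
  refine h.congr' ?_
  filter_upwards [eventually_gt_atTop 0] with n hn
  have hn0 : (0 : ℝ) < n := by exact_mod_cast hn
  have hsq : (√(n : ℝ)) * √(n : ℝ) = n := Real.mul_self_sqrt hn0.le
  have hexp : Real.exp (((z : ℝ) + 1 / 2) * ((harmonic n : ℝ) - Real.log n)) *
      ((n : ℝ) ^ z * √(n : ℝ)) = Real.exp (((z : ℝ) + 1 / 2) * (harmonic n : ℝ)) := by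
    rw [mul_sub, Real.exp_sub, mul_comm (z + 1 / 2 : ℝ) (Real.log n), ← Real.rpow_def_of_pos hn0,
      Real.rpow_add hn0, Real.rpow_natCast, ← Real.sqrt_eq_rpow, div_mul_cancel₀]
    positivity
  unfold barnesPartialRatio
  simp only [Function.comp, Stirling.stirlingSeq]
  rw [Real.exp_sub, ← hexp, Real.sqrt_mul (by norm_num) (n : ℝ), div_pow, ← Real.exp_nat_mul, mul_one]
  have e1 : (1 + ((z : ℝ) + 1) / n) = (n + z + 1) / n := by field_simp; ring
  rw [e1, div_pow]
  have h5 : √(2 : ℝ) ≠ 0 := by positivity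
  have h6 : √(n : ℝ) ≠ 0 := by positivity
  have h7 : (n.factorial : ℝ) ≠ 0 := by positivity
  field_simp

/-- Together with the limit of the quotients this is `G(z + 2) = Γ(z + 1) G(z + 1)` at natural
numbers `z`. -/
theorem barnesPrefactor_succ (z : ℕ) :
    barnesPrefactor ((z : ℝ) + 1) * (z.factorial * Real.exp ((z : ℝ) + 1) *
      Real.exp (((z : ℝ) + 1 / 2) * Real.eulerMascheroniConstant) * (√Real.pi * √2)⁻¹) =
      barnesPrefactor z * z.factorial := by
  unfold barnesPrefactor
  have hpi : (0 : ℝ) < 2 * Real.pi := by positivity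
  have hs : √Real.pi * √2 = (2 * Real.pi) ^ ((1 : ℝ) / 2) := by
    rw [mul_comm, ← Real.sqrt_mul (by norm_num), Real.sqrt_eq_rpow]
  have he : Real.exp (-(((z : ℝ) + 1) + (1 + Real.eulerMascheroniConstant) * ((z : ℝ) + 1) ^ 2) / 2) *
      Real.exp ((z : ℝ) + 1) * Real.exp (((z : ℝ) + 1 / 2) * Real.eulerMascheroniConstant) =
      Real.exp (-((z : ℝ) + (1 + Real.eulerMascheroniConstant) * (z : ℝ) ^ 2) / 2) := by
    rw [← Real.exp_add, ← Real.exp_add]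
    congr 1
    ring
  have hp : (0 : ℝ) < (2 * Real.pi) ^ ((1 : ℝ) / 2) := Real.rpow_pos_of_pos hpi _
  rw [hs, ← he, add_div, Real.rpow_add hpi]
  field_simp

open Filter Topology in
theorem exists_tendsto_prod_barnesFactor (z : ℕ) :
    ∃ L : ℝ, Tendsto (fun n => ∏ i ∈ Finset.range n, barnesFactor z i) atTop (𝓝 L) ∧
      0 < L ∧ barnesPrefactor z * L = ∏ i ∈ Finset.range z, (i.factorial : ℝ) := by
  induction z with
  | zero => exact ⟨1, by simp [barnesFactor], one_pos, by simp [barnesPrefactor]⟩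
  | succ z ih =>
    obtain ⟨L, hL, hL0, hLe⟩ := ih
    refine ⟨L * (z.factorial * Real.exp ((z : ℝ) + 1) *
        Real.exp (((z : ℝ) + 1 / 2) * Real.eulerMascheroniConstant) * (√Real.pi * √2)⁻¹),
        ?_, ?_, ?_⟩
    · push_cast
      simp only [prod_barnesFactor_succ]
      exact hL.mul (tendsto_barnesPartialRatio z)
    · positivity
    · rw [Finset.prod_range_succ, ← hLe]
      push_cast
      linear_combination L * barnesPrefactor_succ z

/-- From `log (1 + x) ≥ 2 x / (x + 2) ≥ x - x² / 2`. -/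
theorem one_le_barnesFactor {z : ℝ} (hz : 0 ≤ z) (n : ℕ) : 1 ≤ barnesFactor z n := by
  have hn : (0 : ℝ) < (n : ℝ) + 1 := by positivity
  set x := z / ((n : ℝ) + 1) with hx
  have hx0 : 0 ≤ x := by positivity
  have hzx : z = x * ((n : ℝ) + 1) := by rw [hx]; field_simp
  have h1 : x - x ^ 2 / 2 ≤ Real.log (1 + x) := by
    refine le_trans ?_ (Real.le_log_one_add_of_nonneg hx0)
    rw [le_div_iff₀ (by positivity)]
    nlinarith [pow_nonneg hx0 3]
  unfold barnesFactor
  rw [← hx, ← Real.exp_log (show 0 < 1 + x by positivity), ← Real.exp_nat_mul, ← Real.exp_add,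
    Real.one_le_exp_iff]
  have h2 : z ^ 2 / (2 * ((n : ℝ) + 1)) = ((n : ℝ) + 1) * (x ^ 2 / 2) := by
    rw [hzx]; field_simp
  rw [h2, hzx]
  push_cast
  nlinarith

open Filter Topology in
/-- The factors are at least `1`, so their logarithms are nonnegative and convergence of the
partial products already gives unconditional convergence. -/
theorem hasProd_barnesFactor {z L : ℝ} (hz : 0 ≤ z) (hL : 0 < L)
    (h : Tendsto (fun n => ∏ i ∈ Finset.range n, barnesFactor z i) atTop (𝓝 L)) :
    HasProd (barnesFactor z) L := by
  have hpos : ∀ n, 0 < barnesFactor z n := fun n => one_pos.trans_le (one_le_barnesFactor hz n)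
  have hs : HasSum (fun n => Real.log (barnesFactor z n)) (Real.log L) := by
    rw [hasSum_iff_tendsto_nat_of_nonneg (fun n => Real.log_nonneg (one_le_barnesFactor hz n))]
    refine (h.log hL.ne').congr fun n => ?_
    rw [Real.log_prod fun i _ => (hpos i).ne']
  have := hs.rexp
  rw [Real.exp_log hL] at this
  convert! this using 1
  funext n
  simp [Real.exp_log (hpos n)]

theorem barnesG_natCast_add_one (n : ℕ) :
    barnesG ((n : ℝ) + 1) = ∏ i ∈ Finset.range n, (i.factorial : ℝ) := by
  obtain ⟨L, hL, hL0, hLe⟩ := exists_tendsto_prod_barnesFactor n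
  rw [barnesG_eq, add_sub_cancel_right, (hasProd_barnesFactor n.cast_nonneg hL0 hL).tprod_eq, hLe]

/-! ### Binomial coefficients with integer lower index -/

/-- The binomial coefficient `binom(n, z)` for an integer `z`, zero if `z` is negative. -/
def chooseInt (n : ℕ) (z : ℤ) : ℕ := if 0 ≤ z then n.choose z.toNat else 0

theorem chooseInt_natCast (n k : ℕ) : chooseInt n k = n.choose k := by simp [chooseInt]

theorem chooseInt_of_neg (n : ℕ) {z : ℤ} (hz : z < 0) : chooseInt n z = 0 := by
  simp [chooseInt, hz]

theorem chooseInt_zero (z : ℤ) : chooseInt 0 z = if z = 0 then 1 else 0 := by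
  rcases lt_trichotomy z 0 with h | rfl | h
  · rw [chooseInt_of_neg _ h, if_neg h.ne]
  · rfl
  · lift z to ℕ using h.le
    rw [chooseInt_natCast, if_neg h.ne', Nat.choose_eq_zero_of_lt (by exact_mod_cast h)]

theorem chooseInt_succ (n : ℕ) (z : ℤ) :
    chooseInt (n + 1) z = chooseInt n (z - 1) + chooseInt n z := by
  rcases lt_trichotomy z 0 with h | rfl | h
  · rw [chooseInt_of_neg _ h, chooseInt_of_neg _ h, chooseInt_of_neg _ (by omega)]
  · simp [chooseInt]
  · obtain ⟨k, rfl⟩ : ∃ k : ℕ, z = ((k + 1 : ℕ) : ℤ) := ⟨z.toNat - 1, by omega⟩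
    have : ((k + 1 : ℕ) : ℤ) - 1 = (k : ℤ) := by push_cast; ring
    rw [this, chooseInt_natCast, chooseInt_natCast, chooseInt_natCast, Nat.choose_succ_succ]

/-! ### Growing diagrams and their column heights -/

/-- The column heights at time `t` of the growing diagram which starts with column heights `a`
and in which step `s` adds one cell to each column in `f s`. -/
def colHeight {N M : ℕ} (a : Fin N → ℕ) (f : Fin M → Finset (Fin N)) (t : ℕ) (c : Fin N) : ℕ :=
  a c + (Finset.univ.filter fun s : Fin M => (s : ℕ) < t ∧ c ∈ f s).card

theorem colHeight_zero {N M : ℕ} (a : Fin N → ℕ) (f : Fin M → Finset (Fin N)) :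
    colHeight a f 0 = a := by
  funext c; simp [colHeight]

theorem colHeight_cons_succ {N M : ℕ} (a : Fin N → ℕ) (e : Finset (Fin N))
    (f : Fin M → Finset (Fin N)) (t : ℕ) :
    colHeight a (Fin.cons e f : Fin (M + 1) → Finset (Fin N)) (t + 1) =
      colHeight (fun c => a c + if c ∈ e then 1 else 0) f t := by
  funext c
  simp only [colHeight, Finset.card_filter, Fin.sum_univ_succ, Fin.cons_zero, Fin.cons_succ,
    Fin.val_zero, Fin.val_succ, Nat.succ_pos, true_and, add_lt_add_iff_right, add_assoc]

theorem colHeight_succ {N M : ℕ} (a : Fin N → ℕ) (f : Fin M → Finset (Fin N)) (s : Fin M)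
    (c : Fin N) : colHeight a f (s + 1) c = colHeight a f s c + if c ∈ f s then 1 else 0 := by
  unfold colHeight
  rw [add_assoc]
  congr 1
  have : (Finset.univ.filter fun x : Fin M => (x : ℕ) < s + 1 ∧ c ∈ f x) =
      (Finset.univ.filter fun x : Fin M => (x : ℕ) < s ∧ c ∈ f x) ∪
        (if c ∈ f s then {s} else ∅) := by
    ext x
    by_cases hc : c ∈ f s
    · simp only [hc, if_true, Finset.mem_filter, Finset.mem_univ, true_and, Finset.mem_union,
        Finset.mem_singleton, Nat.lt_succ_iff_lt_or_eq, or_and_right]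
      refine or_congr_right ⟨fun h => Fin.ext h.1, fun h => by subst h; exact ⟨rfl, hc⟩⟩
    · simp only [hc, if_false, Finset.mem_filter, Finset.mem_univ, true_and, Finset.union_empty,
        Nat.lt_succ_iff_lt_or_eq, or_and_right, or_iff_left_iff_imp]
      rintro ⟨h, h'⟩
      rw [Fin.ext h] at h'
      exact absurd h' hc
  rw [this, Finset.card_union_of_disjoint]
  · split_ifs <;> simp
  · split_ifs <;> simp

theorem colHeight_mono {N M : ℕ} (a : Fin N → ℕ) (f : Fin M → Finset (Fin N)) (c : Fin N) :
    Monotone fun t => colHeight a f t c := by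
  intro t t' h
  refine Nat.add_le_add_left (Finset.card_le_card fun x hx => ?_) _
  simp only [Finset.mem_filter, Finset.mem_univ, true_and] at hx ⊢
  exact ⟨hx.1.trans_le h, hx.2⟩

/-- The sequences of `M` steps that lead from column heights `a` to column heights `b` through
heights that are weakly decreasing from left to right at each time. -/
noncomputable def growthPaths {N : ℕ} (M : ℕ) (a b : Fin N → ℕ) :
    Finset (Fin M → Finset (Fin N)) :=
  open Classical in
  Finset.univ.filter fun f => (∀ t, Antitone (colHeight a f t)) ∧ colHeight a f M = b

theorem mem_growthPaths {N M : ℕ} {a b : Fin N → ℕ} {f : Fin M → Finset (Fin N)} :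
    f ∈ growthPaths M a b ↔ (∀ t, Antitone (colHeight a f t)) ∧ colHeight a f M = b := by
  simp [growthPaths]

theorem growthPaths_eq_empty {N M : ℕ} {a b : Fin N → ℕ} (ha : ¬ Antitone a) :
    growthPaths M a b = ∅ := by
  refine Finset.eq_empty_of_forall_notMem fun f hf => ha ?_
  simpa [colHeight_zero] using (mem_growthPaths.1 hf).1 0

theorem card_growthPaths_zero {N : ℕ} {a b : Fin N → ℕ} (ha : Antitone a) :
    (growthPaths 0 a b).card = if a = b then 1 else 0 := by
  have h : ∀ (f : Fin 0 → Finset (Fin N)) t, colHeight a f t = a := fun f t => by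
    funext c; simp [colHeight]
  split_ifs with hab
  · rw [Finset.card_eq_one]
    refine ⟨Fin.elim0, Finset.eq_singleton_iff_unique_mem.2 ⟨?_, fun f _ => Subsingleton.elim _ _⟩⟩
    subst hab
    exact mem_growthPaths.2 ⟨fun t => by rw [h]; exact ha, h _ _⟩
  · rw [Finset.card_eq_zero]
    refine Finset.eq_empty_of_forall_notMem fun f hf => hab ?_
    simpa [h] using (mem_growthPaths.1 hf).2

theorem card_growthPaths_succ {N M : ℕ} {a b : Fin N → ℕ} (ha : Antitone a) :
    (growthPaths (M + 1) a b).card =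
      ∑ e : Finset (Fin N), (growthPaths M (fun c => a c + if c ∈ e then 1 else 0) b).card := by
  rw [← Finset.card_sigma]
  symm
  refine Finset.card_bij (fun x _ => (Fin.cons x.1 x.2 : Fin (M + 1) → Finset (Fin N))) ?_ ?_ ?_
  · rintro ⟨e, f⟩ hf
    simp only [Finset.mem_sigma, Finset.mem_univ, true_and, mem_growthPaths] at hf ⊢
    refine ⟨fun t => ?_, by rw [colHeight_cons_succ]; exact hf.2⟩
    cases t with
    | zero => rwa [colHeight_zero]
    | succ t => rw [colHeight_cons_succ]; exact hf.1 t
  · rintro ⟨e, f⟩ _ ⟨e', f'⟩ _ h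
    obtain ⟨rfl, rfl⟩ := Fin.cons_injective2 h
    rfl
  · intro g hg
    induction g using Fin.consCases with
    | cons e f =>
      refine ⟨⟨e, f⟩, ?_, rfl⟩
      simp only [Finset.mem_sigma, Finset.mem_univ, true_and, mem_growthPaths] at hg ⊢
      exact ⟨fun t => by rw [← colHeight_cons_succ]; exact hg.1 (t + 1),
        by rw [← colHeight_cons_succ]; exact hg.2⟩

/-! ### Counting non-intersecting walks by a determinant -/

/-- The matrix of the numbers of unrestricted walks from the shifted height `a l - l` to the
shifted height `b i - i` in `M` steps from `{0, 1}`. -/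
def walkMatrix {N : ℕ} (M : ℕ) (a b : Fin N → ℕ) : Matrix (Fin N) (Fin N) ℤ :=
  Matrix.of fun l i => (chooseInt M ((b i : ℤ) - i - (a l - l)) : ℤ)

theorem det_walkMatrix_zero {N : ℕ} {a b : Fin N → ℕ} (ha : Antitone a) (hb : Antitone b) :
    (walkMatrix 0 a b).det = if a = b then 1 else 0 := by
  split_ifs with hab
  · subst hab
    have : walkMatrix 0 a a = 1 := by
      ext l i
      simp only [walkMatrix, Matrix.of_apply, chooseInt_zero, Matrix.one_apply]
      by_cases hli : l = i
      · simp [hli]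
      · have : ¬ ((a i : ℤ) - i - (a l - l) = 0) := by
          intro h
          rcases lt_or_gt_of_ne hli with h' | h'
          · have h1 : (a i : ℤ) ≤ a l := by exact_mod_cast ha h'.le
            have h2 : (l : ℤ) < i := by exact_mod_cast h'
            omega
          · have h1 : (a l : ℤ) ≤ a i := by exact_mod_cast ha h'.le
            have h2 : (i : ℤ) < l := by exact_mod_cast h'
            omega
        simp [hli, this]
    rw [this, Matrix.det_one]
  · rw [Matrix.det_apply]
    refine Finset.sum_eq_zero fun σ _ => ?_
    by_contra hne
    refine hab ?_
    -- A permutation that contributes matches two strictly decreasing sequences, so it is trivial.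
    have h : ∀ i, (b i : ℤ) - i = a (σ i) - (σ i : Fin N) := by
      intro i
      by_contra hi
      refine hne ?_
      rw [Finset.prod_eq_zero (Finset.mem_univ i), smul_zero]
      simp [walkMatrix, chooseInt_zero, sub_eq_zero, hi]
    have hmono : StrictMono σ := by
      intro i i' hii
      by_contra hlt
      rw [not_lt] at hlt
      have h1 : (a (σ i) : ℤ) ≤ a (σ i') := by exact_mod_cast ha hlt
      have h2 : (b i' : ℤ) ≤ b i := by exact_mod_cast hb hii.le
      have h3 : (i : ℤ) < i' := by exact_mod_cast hii
      have h4 : ((σ i' : Fin N) : ℤ) ≤ (σ i : Fin N) := by exact_mod_cast hlt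
      have := h i
      have := h i'
      omega
    have hid : ∀ i, σ i = i := fun i => by
      have := Subsingleton.elim (StrictMono.orderIsoOfSurjective σ hmono σ.surjective)
        (OrderIso.refl (Fin N))
      exact congrArg (fun e : Fin N ≃o Fin N => e i) this
    funext i
    have := h i
    rw [hid] at this
    omega

theorem det_walkMatrix_succ {N : ℕ} (M : ℕ) (a b : Fin N → ℕ) :
    (walkMatrix (M + 1) a b).det =
      ∑ e : Finset (Fin N), (walkMatrix M (fun c => a c + if c ∈ e then 1 else 0) b).det := by
  have h : (walkMatrix (M + 1) a b : Fin N → Fin N → ℤ) =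
      (fun l => walkMatrix M (fun c => a c + 1) b l) + (fun l => walkMatrix M a b l) := by
    funext l i
    simp only [walkMatrix, Matrix.of_apply, Pi.add_apply, chooseInt_succ]
    push_cast
    congr 3
    ring
  have := (Matrix.detRowAlternating (n := Fin N) (R := ℤ)).map_add_univ
    (fun l => walkMatrix M (fun c => a c + 1) b l) (fun l => walkMatrix M a b l)
  rw [← h] at this
  refine this.trans (Finset.sum_congr rfl fun e _ => ?_)
  refine congrArg Matrix.det ?_
  funext l i
  by_cases hl : l ∈ e <;> simp [Finset.piecewise, hl, walkMatrix]

/-- If a single step breaks the monotonicity of the heights, two adjacent shifted heights have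
collided, and the determinant has two equal rows. -/
theorem det_walkMatrix_step_eq_zero {N : ℕ} (M : ℕ) {a b : Fin N → ℕ} (ha : Antitone a)
    (e : Finset (Fin N)) (he : ¬ Antitone fun c => a c + if c ∈ e then 1 else 0) :
    (walkMatrix M (fun c => a c + if c ∈ e then 1 else 0) b).det = 0 := by
  rw [antitone_iff_forall_covBy] at he
  push Not at he
  obtain ⟨c, c', hcc, hlt⟩ := he
  have h1 := ha hcc.le
  have h2 : (c : ℕ) + 1 = c' := by
    rw [Fin.covBy_iff] at hcc
    exact (Nat.covBy_iff_add_one_eq).1 hcc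
  refine Matrix.det_zero_of_row_eq hcc.lt.ne ?_
  funext i
  simp only [walkMatrix, Matrix.of_apply]
  congr 2
  split_ifs at hlt ⊢ <;> push_cast <;> omega

/-- Non-intersecting lattice paths: the paths are counted by a determinant. -/
theorem card_growthPaths {N : ℕ} (M : ℕ) {a b : Fin N → ℕ} (ha : Antitone a) (hb : Antitone b) :
    ((growthPaths M a b).card : ℤ) = (walkMatrix M a b).det := by
  induction M generalizing a with
  | zero => rw [card_growthPaths_zero ha, det_walkMatrix_zero ha hb]; split_ifs <;> rfl
  | succ M ih =>
    rw [card_growthPaths_succ ha, det_walkMatrix_succ, Nat.cast_sum]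
    refine Finset.sum_congr rfl fun e _ => ?_
    by_cases he : Antitone fun c => a c + if c ∈ e then 1 else 0
    · exact ih he
    · rw [growthPaths_eq_empty he, det_walkMatrix_step_eq_zero M ha e he]
      rfl

/-! ### Semistandard tableaux as growing diagrams -/

/-- The cells of the skew diagram `μ / ν`. -/
abbrev SkewCell (μ ν : YoungDiagram) : Type := {c : ℕ × ℕ // c ∈ μ.cells \ ν.cells}

theorem mem_skew_iff {μ ν : YoungDiagram} {r c : ℕ} :
    (r, c) ∈ μ.cells \ ν.cells ↔ ν.colLen c ≤ r ∧ r < μ.colLen c := by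
  rw [Finset.mem_sdiff, YoungDiagram.mem_cells, YoungDiagram.mem_cells,
    YoungDiagram.mem_iff_lt_colLen, YoungDiagram.mem_iff_lt_colLen, not_lt, and_comm]

/-- The growth of a tableau: step `t` adds a cell to the columns that contain the entry `t`. -/
noncomputable def tableauSteps {M : ℕ} (N : ℕ) {μ ν : YoungDiagram} (T : SkewCell μ ν → Fin M) :
    Fin M → Finset (Fin N) :=
  open Classical in
  fun t => Finset.univ.filter fun c => ∃ x : SkewCell μ ν, x.1.2 = c ∧ T x = t

theorem mem_tableauSteps {M N : ℕ} {μ ν : YoungDiagram} {T : SkewCell μ ν → Fin M} {t : Fin M}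
    {c : Fin N} : c ∈ tableauSteps N T t ↔ ∃ x : SkewCell μ ν, x.1.2 = c ∧ T x = t := by
  simp [tableauSteps]

/-- The rows in which column `c` of a tableau has an entry smaller than `t`. -/
noncomputable def smallRows {M : ℕ} {μ ν : YoungDiagram} (T : SkewCell μ ν → Fin M) (t c : ℕ) :
    Finset ℕ :=
  (Finset.univ.filter fun x : SkewCell μ ν => x.1.2 = c ∧ (T x : ℕ) < t).image fun x => x.1.1

theorem mem_smallRows {M : ℕ} {μ ν : YoungDiagram} {T : SkewCell μ ν → Fin M} {t c i : ℕ} :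
    i ∈ smallRows T t c ↔ ∃ h : (i, c) ∈ μ.cells \ ν.cells, (T ⟨(i, c), h⟩ : ℕ) < t := by
  simp only [smallRows, Finset.mem_image, Finset.mem_filter, Finset.mem_univ, true_and]
  constructor
  · rintro ⟨⟨⟨i, c⟩, h⟩, ⟨rfl, ht⟩, rfl⟩
    exact ⟨h, ht⟩
  · rintro ⟨h, ht⟩
    exact ⟨⟨(i, c), h⟩, ⟨rfl, ht⟩, rfl⟩

theorem colHeight_tableauSteps {M N : ℕ} {μ ν : YoungDiagram} {T : SkewCell μ ν → Fin M}
    (hT : IsSkewSemistandard μ ν T) (t : ℕ) (c : Fin N) :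
    colHeight (fun c : Fin N => ν.colLen c) (tableauSteps N T) t c =
      ν.colLen c + (smallRows T t c).card := by
  unfold colHeight smallRows
  congr 1
  rw [Finset.card_image_of_injOn]
  · symm
    refine Finset.card_bij (fun x _ => T x) ?_ ?_ ?_
    · intro x hx
      simp only [Finset.mem_filter, Finset.mem_univ, true_and] at hx ⊢
      exact ⟨hx.2, mem_tableauSteps.2 ⟨x, hx.1, rfl⟩⟩
    · intro x hx y hy hxy
      simp only [Finset.mem_filter, Finset.mem_univ, true_and] at hx hy
      have hc : x.1.2 = y.1.2 := hx.1.trans hy.1.symm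
      rcases lt_trichotomy x.1.1 y.1.1 with h | h | h
      · exact absurd hxy (hT.2 x y hc h).ne
      · exact Subtype.ext (Prod.ext h hc)
      · exact absurd hxy (hT.2 y x hc.symm h).ne'
    · intro s hs
      simp only [Finset.mem_filter, Finset.mem_univ, true_and, mem_tableauSteps] at hs
      obtain ⟨hst, x, hx, rfl⟩ := hs
      exact ⟨x, by simp [hx, hst], rfl⟩
  · intro x hx y hy hxy
    simp only [Finset.coe_filter, Finset.mem_univ, true_and, Set.mem_ofPred_eq] at hx hy
    exact Subtype.ext (Prod.ext hxy (hx.1.trans hy.1.symm))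

/-- In a semistandard tableau the entries smaller than `t` of a column are its topmost cells, down
to the height at time `t`. -/
theorem lt_iff_lt_colHeight_tableauSteps {M N : ℕ} {μ ν : YoungDiagram}
    {T : SkewCell μ ν → Fin M} (hT : IsSkewSemistandard μ ν T) (t : ℕ) (c : Fin N) {r : ℕ}
    (h : (r, (c : ℕ)) ∈ μ.cells \ ν.cells) :
    (T ⟨(r, c), h⟩ : ℕ) < t ↔
      r < colHeight (fun c : Fin N => ν.colLen c) (tableauSteps N T) t c := by
  obtain ⟨h1, h2⟩ := mem_skew_iff.1 h
  rw [colHeight_tableauSteps hT]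
  constructor
  · intro hlt
    have : Finset.Icc (ν.colLen c) r ⊆ smallRows T t c := by
      intro i hi
      rw [Finset.mem_Icc] at hi
      have hi' : (i, (c : ℕ)) ∈ μ.cells \ ν.cells := mem_skew_iff.2 ⟨hi.1, hi.2.trans_lt h2⟩
      refine mem_smallRows.2 ⟨hi', ?_⟩
      rcases hi.2.lt_or_eq with hir | rfl
      · have h3 : (T ⟨(i, c), hi'⟩ : ℕ) < T ⟨(r, c), h⟩ := hT.2 _ _ rfl hir
        exact h3.trans hlt
      · exact hlt
    have := Finset.card_le_card this
    rw [Nat.card_Icc] at this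
    omega
  · intro hlt
    by_contra hge
    rw [not_lt] at hge
    have : smallRows T t c ⊆ Finset.Ico (ν.colLen c) r := by
      intro i hi
      obtain ⟨hi, hit⟩ := mem_smallRows.1 hi
      refine Finset.mem_Ico.2 ⟨(mem_skew_iff.1 hi).1, ?_⟩
      by_contra hri
      rw [not_lt] at hri
      rcases hri.lt_or_eq with hlt' | rfl
      · have h3 : (T ⟨(r, c), h⟩ : ℕ) < T ⟨(i, c), hi⟩ := hT.2 _ _ rfl hlt'
        omega
      · omega
    have := Finset.card_le_card this
    rw [Nat.card_Ico] at this
    omega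

theorem colLen_le_colLen {μ ν : YoungDiagram} (h : ν ≤ μ) (c : ℕ) : ν.colLen c ≤ μ.colLen c := by
  by_contra hlt
  rw [not_le, ← YoungDiagram.mem_iff_lt_colLen] at hlt
  exact lt_irrefl _ (YoungDiagram.mem_iff_lt_colLen.1 (h hlt))

theorem tableauSteps_mem_growthPaths {M N : ℕ} {μ ν : YoungDiagram} (hνμ : ν ≤ μ)
    {T : SkewCell μ ν → Fin M} (hT : IsSkewSemistandard μ ν T) :
    tableauSteps N T ∈ growthPaths M (fun c : Fin N => ν.colLen c) (fun c => μ.colLen c) := by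
  have hfin : ∀ t (c : Fin N), colHeight (fun c : Fin N => ν.colLen c) (tableauSteps N T) t c ≤
      μ.colLen c := by
    intro t c
    have : smallRows T t c ⊆ Finset.Ico (ν.colLen c) (μ.colLen c) := fun i hi =>
      Finset.mem_Ico.2 (mem_skew_iff.1 (mem_smallRows.1 hi).1)
    have := Finset.card_le_card this
    have := colLen_le_colLen hνμ c
    rw [Nat.card_Ico] at *
    rw [colHeight_tableauSteps hT]
    omega
  refine mem_growthPaths.2 ⟨fun t c c' hcc => ?_, ?_⟩
  · by_contra hlt
    rw [not_le] at hlt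
    have h0 : ν.colLen c ≤ colHeight (fun c : Fin N => ν.colLen c) (tableauSteps N T) t c :=
      Nat.le_add_right _ _
    set r := colHeight (fun c : Fin N => ν.colLen c) (tableauSteps N T) t c with hr
    have h1 : r < μ.colLen c' := hlt.trans_le (hfin t c')
    have hrc : (r, (c : ℕ)) ∈ μ.cells \ ν.cells :=
      mem_skew_iff.2 ⟨h0, h1.trans_le (μ.colLen_anti _ _ hcc)⟩
    have hrc' : (r, (c' : ℕ)) ∈ μ.cells \ ν.cells :=
      mem_skew_iff.2 ⟨(ν.colLen_anti _ _ hcc).trans h0, h1⟩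
    have h2 := (lt_iff_lt_colHeight_tableauSteps hT t c' hrc').2 hlt
    have h3 : ¬ (T ⟨(r, c), hrc⟩ : ℕ) < t := fun h =>
      (lt_irrefl r) ((lt_iff_lt_colHeight_tableauSteps hT t c hrc).1 h)
    have hne : (c : ℕ) < c' := by
      refine lt_of_le_of_ne hcc fun h => ?_
      obtain rfl := Fin.ext h
      exact lt_irrefl _ hlt
    have h4 : (T ⟨(r, c), hrc⟩ : ℕ) ≤ T ⟨(r, c'), hrc'⟩ := hT.1 _ _ rfl hne
    omega
  · funext c
    have : smallRows T M c = Finset.Ico (ν.colLen c) (μ.colLen c) := by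
      ext i
      rw [mem_smallRows, Finset.mem_Ico, ← mem_skew_iff]
      exact ⟨fun h => h.1, fun h => ⟨h, Fin.is_lt _⟩⟩
    rw [colHeight_tableauSteps hT, this, Nat.card_Ico]
    exact Nat.add_sub_of_le (colLen_le_colLen hνμ c)

theorem eq_of_tableauSteps_eq {M N : ℕ} {μ ν : YoungDiagram} (hN : μ.rowLen 0 ≤ N)
    {T T' : SkewCell μ ν → Fin M} (hT : IsSkewSemistandard μ ν T)
    (hT' : IsSkewSemistandard μ ν T') (h : tableauSteps N T = tableauSteps N T') : T = T' := by
  funext ⟨⟨r, c⟩, hrc⟩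
  have hc : c < N := by
    have h1 : (r, c) ∈ μ := (Finset.mem_sdiff.1 hrc).1
    exact (YoungDiagram.mem_iff_lt_rowLen.1 (μ.up_left_mem (Nat.zero_le r) le_rfl h1)).trans_le hN
  have key : ∀ t : ℕ, (T ⟨(r, c), hrc⟩ : ℕ) < t ↔ (T' ⟨(r, c), hrc⟩ : ℕ) < t := fun t => by
    rw [lt_iff_lt_colHeight_tableauSteps hT t ⟨c, hc⟩ hrc, h,
      ← lt_iff_lt_colHeight_tableauSteps hT' t ⟨c, hc⟩ hrc]
  have h1 := (key (T ⟨(r, c), hrc⟩ + 1)).1 (Nat.lt_succ_self _)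
  have h2 := (key (T' ⟨(r, c), hrc⟩ + 1)).2 (Nat.lt_succ_self _)
  exact Fin.ext (by omega)

/-- Every row of a column between its first and its last height is passed at some step. -/
theorem exists_colHeight_step {N M : ℕ} (a : Fin N → ℕ) (f : Fin M → Finset (Fin N)) (c : Fin N)
    {r : ℕ} (h0 : a c ≤ r) (h1 : r < colHeight a f M c) :
    ∃ s : Fin M, colHeight a f s c ≤ r ∧ r < colHeight a f (s + 1) c := by
  classical
  have hex : ∃ t, r < colHeight a f t c := ⟨M, h1⟩
  have hpos : Nat.find hex ≠ 0 := fun h => by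
    have := Nat.find_spec hex
    rw [h, colHeight_zero] at this
    omega
  obtain ⟨t, ht⟩ := Nat.exists_eq_succ_of_ne_zero hpos
  have htM : t < M := by
    have := Nat.find_min' hex h1
    omega
  refine ⟨⟨t, htM⟩, not_lt.1 (Nat.find_min hex (ht ▸ Nat.lt_succ_self t)), ?_⟩
  have := Nat.find_spec hex
  rwa [ht] at this

/-- The entry of a cell is the step at which the height of its column passes its row. -/
theorem exists_tableauSteps_eq {M N : ℕ} {μ ν : YoungDiagram} (hN : μ.rowLen 0 ≤ N)
    {f : Fin M → Finset (Fin N)}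
    (hf : f ∈ growthPaths M (fun c : Fin N => ν.colLen c) (fun c => μ.colLen c)) :
    ∃ T : SkewCell μ ν → Fin M, IsSkewSemistandard μ ν T ∧ tableauSteps N T = f := by
  obtain ⟨hanti, hfin⟩ := mem_growthPaths.1 hf
  set a : Fin N → ℕ := fun c => ν.colLen c with ha
  have hcN : ∀ x : SkewCell μ ν, x.1.2 < N := fun x =>
    (YoungDiagram.mem_iff_lt_rowLen.1
      (μ.up_left_mem (Nat.zero_le x.1.1) le_rfl (Finset.mem_sdiff.1 x.2).1)).trans_le hN
  have hex : ∀ x : SkewCell μ ν, ∃ s : Fin M, colHeight a f s ⟨x.1.2, hcN x⟩ ≤ x.1.1 ∧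
      x.1.1 < colHeight a f (s + 1) ⟨x.1.2, hcN x⟩ := fun x => by
    obtain ⟨h1, h2⟩ := mem_skew_iff.1 x.2
    refine exists_colHeight_step a f _ h1 ?_
    rw [hfin]
    exact h2
  choose T hT1 hT2 using hex
  have hlt : ∀ x (t : ℕ), x.1.1 < colHeight a f t ⟨x.1.2, hcN x⟩ → (T x : ℕ) < t := by
    intro x t h
    by_contra hle
    rw [not_lt] at hle
    have := colHeight_mono a f ⟨x.1.2, hcN x⟩ hle
    have := hT1 x
    simp only at *
    omega
  refine ⟨T, ⟨fun x y hxy hlt' => ?_, fun x y hxy hlt' => ?_⟩, ?_⟩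
  · have h1 := hanti (T y + 1) (show (⟨x.1.2, hcN x⟩ : Fin N) ≤ ⟨y.1.2, hcN y⟩ from hlt'.le)
    have h2 := hT2 y
    rw [← hxy] at h2
    exact Nat.lt_succ_iff.1 (hlt x _ (h2.trans_le h1))
  · have hcc : (⟨x.1.2, hcN x⟩ : Fin N) = ⟨y.1.2, hcN y⟩ := Fin.ext hxy
    have h1 := hT2 y
    have h2 := hT1 x
    rw [hcc] at h2
    -- Otherwise the heights would pass two rows in one step.
    by_contra hle
    rw [not_lt] at hle
    have h3 := colHeight_mono a f ⟨y.1.2, hcN y⟩ (show (T y : ℕ) ≤ T x from hle)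
    have h4 := colHeight_succ a f (T y) ⟨y.1.2, hcN y⟩
    simp only at h3
    split_ifs at h4 <;> omega
  · funext s
    ext c
    rw [mem_tableauSteps]
    have hstep := colHeight_succ a f s c
    constructor
    · rintro ⟨x, hx, rfl⟩
      have hxc : (⟨x.1.2, hcN x⟩ : Fin N) = c := Fin.ext hx
      have h1 := hT1 x
      have h2 := hT2 x
      rw [hxc] at h1 h2
      by_contra hc
      rw [if_neg hc] at hstep
      omega
    · intro hc
      rw [if_pos hc] at hstep
      have h1 : ν.colLen c ≤ colHeight a f s c := Nat.le_add_right _ _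
      have h2 : colHeight a f s c < μ.colLen c := by
        have h3 := colHeight_mono a f c (show (s : ℕ) + 1 ≤ M from s.2)
        have h4 := congrFun hfin c
        simp only at h3 h4
        omega
      refine ⟨⟨(colHeight a f s c, c), mem_skew_iff.2 ⟨h1, h2⟩⟩, rfl, ?_⟩
      set x : SkewCell μ ν := ⟨(colHeight a f s c, c), mem_skew_iff.2 ⟨h1, h2⟩⟩ with hx
      have h5 : (T x : ℕ) < s + 1 := hlt x _ (by
        show colHeight a f s c < colHeight a f (s + 1) c
        omega)
      refine Fin.ext (le_antisymm (Nat.lt_succ_iff.1 h5) ?_)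
      by_contra hlt'
      rw [not_le] at hlt'
      have h6 : colHeight a f (T x + 1) c ≤ colHeight a f s c :=
        colHeight_mono a f c (Nat.succ_le_of_lt hlt')
      have h7 : colHeight a f s c < colHeight a f (T x + 1) c := hT2 x
      omega

open Classical in
/-- Semistandard tableaux are the same as growth paths. -/
theorem card_skewSemistandard {M N : ℕ} {μ ν : YoungDiagram} (hνμ : ν ≤ μ)
    (hN : μ.rowLen 0 ≤ N) :
    (Finset.univ.filter fun T : SkewCell μ ν → Fin M => IsSkewSemistandard μ ν T).card =
      (growthPaths M (fun c : Fin N => ν.colLen c) (fun c => μ.colLen c)).card := by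
  refine Finset.card_bij (fun T _ => tableauSteps N T) ?_ ?_ ?_
  · exact fun T hT => tableauSteps_mem_growthPaths hνμ (Finset.mem_filter.1 hT).2
  · exact fun T hT T' hT' h =>
      eq_of_tableauSteps_eq hN (Finset.mem_filter.1 hT).2 (Finset.mem_filter.1 hT').2 h
  · intro f hf
    obtain ⟨T, hT, rfl⟩ := exists_tableauSteps_eq hN hf
    exact ⟨T, Finset.mem_filter.2 ⟨Finset.mem_univ _, hT⟩, rfl⟩

theorem eval_skewSchur_one (M N : ℕ) {μ ν : YoungDiagram} (hμ : μ.rowLen 0 ≤ N)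
    (hν : ν.rowLen 0 ≤ N) :
    MvPolynomial.eval (fun _ : Fin M => (1 : ℝ)) (skewSchur (Fin M) ℝ μ ν) =
      (growthPaths M (fun c : Fin N => ν.colLen c) (fun c => μ.colLen c)).card := by
  unfold skewSchur
  split_ifs with h
  · rw [← card_skewSemistandard h hμ]
    simp
  · rw [map_zero]
    symm
    rw [Nat.cast_eq_zero, Finset.card_eq_zero]
    refine Finset.eq_empty_of_forall_notMem fun f hf => h ?_
    rintro ⟨r, c⟩ hrc
    have hc : c < N := (YoungDiagram.mem_iff_lt_rowLen.1
      (ν.up_left_mem (Nat.zero_le r) le_rfl hrc)).trans_le hν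
    have h1 := congrFun (mem_growthPaths.1 hf).2 ⟨c, hc⟩
    have h2 : ν.colLen c ≤ _ := Nat.le_add_right (ν.colLen c)
      (Finset.univ.filter fun s : Fin M => (s : ℕ) < M ∧ (⟨c, hc⟩ : Fin N) ∈ f s).card
    have h3 := YoungDiagram.mem_iff_lt_colLen.1 hrc
    refine YoungDiagram.mem_iff_lt_colLen.2 (h3.trans_le (h2.trans ?_))
    exact h1.le

/-- The dual Jacobi–Trudi formula at `1^M`. -/
theorem eval_skewSchur_one_eq_det (M N : ℕ) {μ ν : YoungDiagram} (hμ : μ.rowLen 0 ≤ N)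
    (hν : ν.rowLen 0 ≤ N) :
    MvPolynomial.eval (fun _ : Fin M => (1 : ℝ)) (skewSchur (Fin M) ℝ μ ν) =
      ((walkMatrix M (fun c : Fin N => ν.colLen c) (fun c => μ.colLen c)).det : ℝ) := by
  rw [eval_skewSchur_one M N hμ hν, ← card_growthPaths M (fun c c' h => ν.colLen_anti _ _ h)
    (fun c c' h => μ.colLen_anti _ _ h), Int.cast_natCast]

/-! ### A binomial summation of Pfaff–Saalschütz type -/

/-- Vandermonde's identity as a sum over a range. -/
theorem sum_choose_mul_choose_sub (a b n : ℕ) :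
    ∑ i ∈ Finset.range (n + 1), a.choose i * b.choose (n - i) = (a + b).choose n := by
  rw [Nat.add_choose_eq, Finset.Nat.sum_antidiagonal_eq_sum_range_succ_mk]

/-- Both sides count the pairs of disjoint subsets of sizes `s` and `t`. -/
theorem choose_mul_choose_sub_comm (γ s t : ℕ) :
    γ.choose s * (γ - s).choose t = γ.choose t * (γ - t).choose s := by
  have key : ∀ s t, γ.choose s * (γ - s).choose t = γ.choose (s + t) * (s + t).choose s := by
    intro s t
    rw [Nat.choose_mul (Nat.le_add_right s t), Nat.add_sub_cancel_left]
  rw [key, key, add_comm t s, Nat.choose_symm_add]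

/-- A form of the Pfaff–Saalschütz summation, due to Nanjundiah. The proof expands
`binom(q + γ, p)` by Vandermonde's identity over `i`, then `binom(p - i + δ, q - i)` over
`l = r - i`, and sums over `i` first. -/
theorem sum_choose_mul_choose_mul_choose (γ δ p q : ℕ) :
    ∑ r ∈ Finset.range (min p q + 1), γ.choose (p - r) * (γ + δ + r).choose r * δ.choose (q - r) =
      (p + δ).choose q * (q + γ).choose p := by
  have hswap : ∀ F : ℕ → ℕ → ℕ,
      ∑ i ∈ Finset.range (min p q + 1), ∑ r ∈ Finset.Ico i (min p q + 1), F i r =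
      ∑ r ∈ Finset.range (min p q + 1), ∑ i ∈ Finset.range (r + 1), F i r := by
    intro F
    refine Finset.sum_comm' fun i r => ?_
    simp only [Finset.mem_range, Finset.mem_Ico]
    omega
  have hterm : ∀ i ∈ Finset.range (min p q + 1),
      (p + δ).choose q * (q.choose i * γ.choose (p - i)) =
      ∑ r ∈ Finset.Ico i (min p q + 1),
        δ.choose (q - r) * γ.choose (p - r) * ((p + δ).choose i * (γ - (p - r)).choose (r - i)) := by
    intro i hi
    rw [Finset.mem_range] at hi
    have hip : i ≤ p := by omega
    have hiq : i ≤ q := by omega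
    have h1 : (p + δ).choose q * q.choose i = (p + δ).choose i * (p - i + δ).choose (q - i) := by
      rw [Nat.choose_mul hiq, show p + δ - i = p - i + δ by omega]
    have h2 : (p - i + δ).choose (q - i) =
        ∑ l ∈ Finset.range (min p q + 1 - i), (p - i).choose l * δ.choose (q - i - l) := by
      rw [← sum_choose_mul_choose_sub]
      symm
      refine Finset.sum_subset (fun l => by simp only [Finset.mem_range]; omega) fun l hl hl' => ?_
      rw [Finset.mem_range] at hl hl'
      rw [Nat.choose_eq_zero_of_lt (show p - i < l by omega), zero_mul]
    rw [← mul_assoc, h1, h2, Finset.sum_Ico_eq_sum_range, Finset.mul_sum, Finset.sum_mul]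
    refine Finset.sum_congr rfl fun l hl => ?_
    rw [Finset.mem_range] at hl
    have h3 : γ.choose (p - i) * (p - i).choose l =
        γ.choose (p - (i + l)) * (γ - (p - (i + l))).choose l := by
      rw [← choose_mul_choose_sub_comm, Nat.choose_mul (show l ≤ p - i by omega),
        show p - i - l = p - (i + l) by omega]
    rw [Nat.add_sub_cancel_left, show q - i - l = q - (i + l) by omega]
    linear_combination ((p + δ).choose i * δ.choose (q - (i + l))) * h3
  calc _ = ∑ r ∈ Finset.range (min p q + 1), ∑ i ∈ Finset.range (r + 1),
        δ.choose (q - r) * γ.choose (p - r) *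
          ((p + δ).choose i * (γ - (p - r)).choose (r - i)) := by
        refine Finset.sum_congr rfl fun r hr => ?_
        rw [Finset.mem_range] at hr
        rw [← Finset.mul_sum, sum_choose_mul_choose_sub]
        by_cases h : p - r ≤ γ
        · rw [show p + δ + (γ - (p - r)) = γ + δ + r by omega]
          ring
        · rw [Nat.choose_eq_zero_of_lt (not_le.1 h)]
          ring
    _ = ∑ i ∈ Finset.range (min p q + 1), (p + δ).choose q * (q.choose i * γ.choose (p - i)) := by
        rw [← hswap]
        exact (Finset.sum_congr rfl hterm).symm
    _ = _ := by
        rw [← Finset.mul_sum, ← sum_choose_mul_choose_sub q γ p]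
        congr 1
        refine Finset.sum_subset (fun l => by simp only [Finset.mem_range]; omega) fun l hl hl' => ?_
        rw [Finset.mem_range] at hl hl'
        rw [Nat.choose_eq_zero_of_lt (show q < l by omega), zero_mul]

/-! ### Factorization of the binomial Toeplitz matrix -/

/-- The lower triangular Toeplitz matrix with symbol `(1 + t)^x`. -/
def toeplitzChoose (n : ℕ) (x : ℤ) : Matrix (Fin n) (Fin n) ℝ :=
  Matrix.of fun p r => if (r : ℕ) ≤ p then ((Ring.choose x ((p : ℕ) - r) : ℤ) : ℝ) else 0

/-- The exponents of the symbols add, by the Chu–Vandermonde identity. -/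
theorem toeplitzChoose_mul (n : ℕ) (x y : ℤ) :
    toeplitzChoose n x * toeplitzChoose n y = toeplitzChoose n (x + y) := by
  ext p q
  simp only [Matrix.mul_apply, toeplitzChoose, Matrix.of_apply]
  rw [Fin.sum_univ_eq_sum_range (fun r => (if r ≤ (p : ℕ) then
    ((Ring.choose x ((p : ℕ) - r) : ℤ) : ℝ) else 0) *
    (if (q : ℕ) ≤ r then ((Ring.choose y (r - q) : ℤ) : ℝ) else 0)) n]
  split_ifs with hqp
  · rw [add_comm x y, Ring.add_choose_eq _ (Commute.all y x),
      Finset.Nat.sum_antidiagonal_eq_sum_range_succ_mk, Int.cast_sum]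
    have hsub : Finset.Ico (q : ℕ) (p + 1) ⊆ Finset.range n := fun r hr => by
      rw [Finset.mem_Ico] at hr
      rw [Finset.mem_range]
      omega
    rw [← Finset.sum_subset hsub, Finset.sum_Ico_eq_sum_range,
      show (p : ℕ) + 1 - q = (p - q : ℕ) + 1 by omega]
    · refine Finset.sum_congr rfl fun i hi => ?_
      rw [Finset.mem_range] at hi
      rw [if_pos (by omega), if_pos (by omega), Nat.add_sub_cancel_left, Int.cast_mul, mul_comm,
        show (p : ℕ) - (q + i) = p - q - i by omega]
    · intro r _ hr
      rw [Finset.mem_Ico, not_and_or] at hr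
      rcases hr with hr | hr
      · rw [if_neg hr, mul_zero]
      · rw [if_neg (by omega), zero_mul]
  · refine Finset.sum_eq_zero fun r _ => ?_
    by_cases h : (q : ℕ) ≤ r
    · rw [if_neg (by omega), zero_mul]
    · rw [if_neg h, mul_zero]

theorem toeplitzChoose_zero (n : ℕ) : toeplitzChoose n 0 = 1 := by
  ext p q
  simp only [toeplitzChoose, Matrix.of_apply, Matrix.one_apply]
  rcases lt_trichotomy p q with h | rfl | h
  · rw [if_neg (not_le.2 (show (p : ℕ) < q from h)), if_neg h.ne]
  · simp
  · rw [if_pos (show (q : ℕ) ≤ p from h.le), if_neg h.ne',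
      Ring.choose_zero_pos ℤ (show 0 < (p : ℕ) - q from Nat.sub_pos_of_lt h), Int.cast_zero]

theorem det_toeplitzChoose (n : ℕ) (x : ℤ) : (toeplitzChoose n x).det = 1 := by
  rw [Matrix.det_of_isLowerTriangular]
  · simp [toeplitzChoose]
  · intro p q h
    exact if_neg (not_le.2 (show (p : ℕ) < q from h))

/-- The Toeplitz matrix of the binomial coefficients `binom(d + e, d - p + q)`, whose symbol is
`(1 + t)^d (1 + t⁻¹)^e`. -/
def binomialToeplitz (n d e : ℕ) : Matrix (Fin n) (Fin n) ℝ :=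
  Matrix.of fun p q => (chooseInt (d + e) ((d : ℤ) - p + q) : ℝ)

/-- The diagonal of the factors `(x + r)! / r!`. -/
noncomputable def factorialRatio (n x : ℕ) : Fin n → ℝ :=
  fun r => ((x + r).factorial : ℝ) / (r : ℕ).factorial

theorem factorialRatio_ne_zero (n x : ℕ) (r : Fin n) : factorialRatio n x r ≠ 0 := by
  unfold factorialRatio; positivity

/-- The Duduchava–Roch factorization, entrywise. -/
theorem factorialRatio_mul_binomialToeplitz_mul (n d e : ℕ) (p q : Fin n) :
    factorialRatio n e p * binomialToeplitz n d e p q * factorialRatio n d q =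
      ∑ r, toeplitzChoose n d p r * factorialRatio n (d + e) r * toeplitzChoose n e q r := by
  have hR : ∑ r, toeplitzChoose n d p r * factorialRatio n (d + e) r * toeplitzChoose n e q r =
      (d + e).factorial * (((p + e).choose q * (q + d).choose p : ℕ) : ℝ) := by
    rw [← sum_choose_mul_choose_mul_choose]
    simp only [toeplitzChoose, Matrix.of_apply, Ring.choose_natCast, factorialRatio]
    rw [Fin.sum_univ_eq_sum_range (fun r => (if r ≤ (p : ℕ) then
      (((d.choose ((p : ℕ) - r) : ℕ) : ℤ) : ℝ) else 0) *
      (((d + e + r).factorial : ℝ) / r.factorial) *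
      (if r ≤ (q : ℕ) then (((e.choose ((q : ℕ) - r) : ℕ) : ℤ) : ℝ) else 0)) n]
    have hsub : Finset.range (min (p : ℕ) q + 1) ⊆ Finset.range n := fun r hr => by
      rw [Finset.mem_range] at hr ⊢
      omega
    rw [← Finset.sum_subset hsub, Nat.cast_sum, Finset.mul_sum]
    · refine Finset.sum_congr rfl fun r hr => ?_
      rw [Finset.mem_range] at hr
      rw [if_pos (by omega), if_pos (by omega)]
      push_cast
      rw [← Nat.choose_symm_add (a := d + e) (b := r), Nat.cast_add_choose]
      field_simp
    · intro r _ hr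
      rw [Finset.mem_range] at hr
      by_cases h : r ≤ (p : ℕ)
      · rw [if_neg (show ¬ r ≤ (q : ℕ) by omega), mul_zero]
      · rw [if_neg h, zero_mul, zero_mul]
  rw [hR]
  simp only [binomialToeplitz, Matrix.of_apply, factorialRatio]
  by_cases h : (0 : ℤ) ≤ (d : ℤ) - p + q
  · by_cases h' : (q : ℕ) ≤ p + e
    · obtain ⟨u, hu⟩ : ∃ u : ℕ, d + (q : ℕ) = p + u := ⟨d + q - p, by omega⟩
      obtain ⟨v, hv⟩ : ∃ v : ℕ, e + (p : ℕ) = q + v := ⟨e + p - q, by omega⟩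
      have huv : d + e = u + v := by omega
      rw [show (d : ℤ) - p + q = (u : ℕ) by omega, chooseInt_natCast, huv, hv, hu,
        show (p : ℕ) + e = q + v by omega, show (q : ℕ) + d = p + u by omega]
      push_cast
      rw [Nat.cast_add_choose, Nat.cast_add_choose, Nat.cast_add_choose]
      field_simp
    · rw [Nat.choose_eq_zero_of_lt (not_le.1 h'), zero_mul, chooseInt,
        if_pos h, Nat.choose_eq_zero_of_lt (by omega)]
      simp
  · rw [chooseInt_of_neg _ (not_le.1 h), Nat.choose_eq_zero_of_lt (show (q : ℕ) + d < p by omega)]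
    simp

theorem diagonal_mul_binomialToeplitz_mul_diagonal (n d e : ℕ) :
    Matrix.diagonal (factorialRatio n e) * binomialToeplitz n d e *
        Matrix.diagonal (factorialRatio n d) =
      toeplitzChoose n d * Matrix.diagonal (factorialRatio n (d + e)) *
        (toeplitzChoose n e).transpose := by
  ext p q
  rw [Matrix.mul_diagonal, Matrix.diagonal_mul, factorialRatio_mul_binomialToeplitz_mul,
    Matrix.mul_apply]
  simp only [Matrix.mul_diagonal, Matrix.transpose_apply]

theorem det_binomialToeplitz (n d e : ℕ) :
    (binomialToeplitz n d e).det =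
      (∏ r, factorialRatio n (d + e) r) /
        ((∏ r, factorialRatio n e r) * ∏ r, factorialRatio n d r) := by
  have h := congrArg Matrix.det (diagonal_mul_binomialToeplitz_mul_diagonal n d e)
  simp only [Matrix.det_mul, Matrix.det_diagonal, Matrix.det_transpose, det_toeplitzChoose,
    one_mul, mul_one] at h
  rw [← h]
  have h1 : ∏ r, factorialRatio n e r ≠ 0 :=
    Finset.prod_ne_zero_iff.2 fun r _ => factorialRatio_ne_zero n e r
  have h2 : ∏ r, factorialRatio n d r ≠ 0 :=
    Finset.prod_ne_zero_iff.2 fun r _ => factorialRatio_ne_zero n d r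
  field_simp

/-- The adjugate, from inverting each factor of the Duduchava–Roch factorization. -/
theorem adjugate_binomialToeplitz (n d e : ℕ) (k j : Fin n) :
    (binomialToeplitz n d e).adjugate k j = (binomialToeplitz n d e).det *
      (factorialRatio n d k * factorialRatio n e j *
        ∑ r, toeplitzChoose n (-e) r k * (factorialRatio n (d + e) r)⁻¹ *
          toeplitzChoose n (-d) r j) := by
  set A := binomialToeplitz n d e with hA
  set E := Matrix.diagonal (factorialRatio n e) with hE
  set D := Matrix.diagonal (factorialRatio n d) with hD
  set F := Matrix.diagonal (factorialRatio n (d + e)) with hF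
  set F' := Matrix.diagonal (fun r => (factorialRatio n (d + e) r)⁻¹) with hF'
  set E' := Matrix.diagonal (fun r => (factorialRatio n e r)⁻¹) with hE'
  set L := toeplitzChoose n d with hL
  set L' := toeplitzChoose n (-d) with hL'
  set U := toeplitzChoose n e with hU
  set U' := toeplitzChoose n (-e) with hU'
  have hLL : L * L' = 1 := by rw [hL, hL', toeplitzChoose_mul, add_neg_cancel, toeplitzChoose_zero]
  have hUU : U.transpose * U'.transpose = 1 := by
    rw [← Matrix.transpose_mul, hU, hU', toeplitzChoose_mul, neg_add_cancel, toeplitzChoose_zero,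
      Matrix.transpose_one]
  have hFF : F * F' = 1 := by
    rw [hF, hF', Matrix.diagonal_mul_diagonal, ← Matrix.diagonal_one]
    congr 1
    funext r
    exact mul_inv_cancel₀ (factorialRatio_ne_zero n _ r)
  have hEE : E' * E = 1 := by
    rw [hE, hE', Matrix.diagonal_mul_diagonal, ← Matrix.diagonal_one]
    congr 1
    funext r
    exact inv_mul_cancel₀ (factorialRatio_ne_zero n _ r)
  have hfac : E * A * D = L * F * U.transpose := diagonal_mul_binomialToeplitz_mul_diagonal n d e
  have hinv : A * (D * (U'.transpose * F' * L') * E) = 1 := by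
    have h1 : E * A * D * (U'.transpose * F' * L') = 1 := by
      rw [hfac]
      calc _ = L * (F * (U.transpose * U'.transpose) * F') * L' := by simp only [Matrix.mul_assoc]
        _ = 1 := by rw [hUU, Matrix.mul_one, hFF, Matrix.mul_one, hLL]
    calc _ = (E' * E) * A * (D * (U'.transpose * F' * L') * E) := by rw [hEE, Matrix.one_mul]
      _ = E' * (E * A * D * (U'.transpose * F' * L')) * E := by simp only [Matrix.mul_assoc]
      _ = 1 := by rw [h1, Matrix.mul_one, hEE]
  have hadj : A.adjugate = A.det • (D * (U'.transpose * F' * L') * E) := by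
    calc A.adjugate = A.adjugate * (A * (D * (U'.transpose * F' * L') * E)) := by
          rw [hinv, Matrix.mul_one]
      _ = _ := by rw [← Matrix.mul_assoc, Matrix.adjugate_mul, Matrix.smul_mul, Matrix.one_mul]
  rw [hadj, Matrix.smul_apply, smul_eq_mul, hD, hE, Matrix.mul_diagonal, Matrix.diagonal_mul,
    Matrix.mul_apply]
  simp only [hF', Matrix.mul_diagonal, Matrix.transpose_apply]
  ring

/-- The reflection `binom(-x, s) = (-1)^s binom(x + s - 1, s)`, with `(-1)^(p + r)` for the sign. -/
theorem toeplitzChoose_neg (n : ℕ) (x : ℤ) (p r : Fin n) :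
    toeplitzChoose n (-x) p r = if (r : ℕ) ≤ p then
      (-1) ^ ((p : ℕ) + r) * ((Ring.choose (x + p - r - 1) ((p : ℕ) - r) : ℤ) : ℝ) else 0 := by
  simp only [toeplitzChoose, Matrix.of_apply]
  split_ifs with h
  · obtain ⟨s, hs⟩ := Nat.exists_eq_add_of_le h
    rw [Ring.choose_neg, hs, Nat.add_sub_cancel_left,
      show x + ((r + s : ℕ) : ℤ) - r - 1 = x + s - 1 by push_cast; ring,
      show (r : ℕ) + s + r = s + 2 * r by ring, pow_add, pow_mul]
    simp [Units.smul_def, Int.negOnePow]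
  · rfl

/-! ### The determinant through the Barnes function -/

theorem barnesG_ratio (x N : ℕ) :
    barnesG ((x : ℝ) + N + 2) = barnesG ((x : ℝ) + 1) *
      ∏ r ∈ Finset.range (N + 1), ((x + r).factorial : ℝ) := by
  have h := barnesG_natCast_add_one (x + (N + 1))
  rw [Finset.prod_range_add, ← barnesG_natCast_add_one] at h
  rw [← h]
  congr 1
  push_cast
  ring

theorem barnesG_natCast_add_one_pos (n : ℕ) : 0 < barnesG ((n : ℝ) + 1) := by
  rw [barnesG_natCast_add_one]
  exact Finset.prod_pos fun i _ => by positivity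

theorem det_binomialToeplitz_eq_barnesG (N d e : ℕ) :
    (binomialToeplitz (N + 1) d e).det =
      barnesG ((N : ℝ) + 2) * (barnesG (((d + e : ℕ) : ℝ) + N + 2) / barnesG (((d + e : ℕ) : ℝ) + 1)) *
        (barnesG ((e : ℝ) + 1) / barnesG ((e : ℝ) + N + 2)) *
        (barnesG ((d : ℝ) + 1) / barnesG ((d : ℝ) + N + 2)) := by
  have h0 : barnesG ((N : ℝ) + 2) = ∏ r ∈ Finset.range (N + 1), (r.factorial : ℝ) := by
    rw [← barnesG_natCast_add_one]
    congr 1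
    push_cast
    ring
  have hprod : ∀ x, ∏ r, factorialRatio (N + 1) x r =
      (∏ r ∈ Finset.range (N + 1), ((x + r).factorial : ℝ)) /
        ∏ r ∈ Finset.range (N + 1), (r.factorial : ℝ) := fun x => by
    rw [← Finset.prod_div_distrib, ← Fin.prod_univ_eq_prod_range]
    rfl
  have hpos : ∀ x : ℕ, ∏ r ∈ Finset.range (N + 1), ((x + r).factorial : ℝ) ≠ 0 := fun x =>
    Finset.prod_ne_zero_iff.2 fun r _ => by positivity
  have hpos0 : ∏ r ∈ Finset.range (N + 1), (r.factorial : ℝ) ≠ 0 :=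
    Finset.prod_ne_zero_iff.2 fun r _ => by positivity
  rw [det_binomialToeplitz, hprod, hprod, hprod, barnesG_ratio, barnesG_ratio, barnesG_ratio, h0]
  have h1 := (barnesG_natCast_add_one_pos (d + e)).ne'
  have h2 := (barnesG_natCast_add_one_pos e).ne'
  have h3 := (barnesG_natCast_add_one_pos d).ne'
  have h4 := hpos (d + e)
  have h5 := hpos e
  have h6 := hpos d
  field_simp

/-! ### The shape `(N^d, j) / (k)` -/

theorem mem_blockRowShape {N d j : ℕ} {hj : j ≤ N} {r c : ℕ} :
    (r, c) ∈ blockRowShape N d j hj ↔ (r < d ∧ c < N) ∨ (r = d ∧ c < j) := by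
  rw [blockRowShape, YoungDiagram.mem_ofRowLens]
  simp only [List.length_append, List.length_replicate, List.length_singleton, List.getElem_append,
    List.getElem_replicate, List.getElem_singleton]
  constructor
  · rintro ⟨h, h'⟩
    split_ifs at h' with hr
    · exact Or.inl ⟨hr, h'⟩
    · exact Or.inr ⟨by omega, h'⟩
  · rintro (⟨h, h'⟩ | ⟨rfl, h'⟩)
    · exact ⟨by omega, by rwa [dif_pos h]⟩
    · exact ⟨by omega, by rwa [dif_neg (lt_irrefl _)]⟩

theorem mem_rowShape {k r c : ℕ} : (r, c) ∈ rowShape k ↔ r = 0 ∧ c < k := by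
  rw [rowShape, YoungDiagram.mem_ofRowLens]
  simp

theorem colLen_eq_of_forall {μ : YoungDiagram} {c m : ℕ} (h : ∀ r, (r, c) ∈ μ ↔ r < m) :
    μ.colLen c = m :=
  eq_of_forall_lt_iff fun r => by rw [← YoungDiagram.mem_iff_lt_colLen, h]

theorem colLen_blockRowShape {N d j : ℕ} (hj : j ≤ N) {c : ℕ} (hc : c < N) :
    (blockRowShape N d j hj).colLen c = d + if c < j then 1 else 0 :=
  colLen_eq_of_forall fun r => by rw [mem_blockRowShape]; split_ifs <;> omega

theorem colLen_rowShape (k c : ℕ) : (rowShape k).colLen c = if c < k then 1 else 0 :=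
  colLen_eq_of_forall fun r => by rw [mem_rowShape]; split_ifs <;> omega

theorem rowLen_zero_blockRowShape_le {N d j : ℕ} (hj : j ≤ N) :
    (blockRowShape N d j hj).rowLen 0 ≤ N := by
  refine not_lt.1 fun h => ?_
  rw [← YoungDiagram.mem_iff_lt_rowLen, mem_blockRowShape] at h
  omega

theorem rowLen_zero_rowShape_le {N k : ℕ} (hk : k ≤ N) : (rowShape k).rowLen 0 ≤ N := by
  refine not_lt.1 fun h => ?_
  rw [← YoungDiagram.mem_iff_lt_rowLen, mem_rowShape] at h
  omega

/-- The shifted column lengths of `(N^d, j)` and `(k)` run through the integers `d + 1 - p` and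
`1 - q` with `p ≠ j` and `q ≠ k`, so the dual Jacobi–Trudi matrix is, up to transposition, the
binomial Toeplitz matrix without row `j` and column `k`. -/
theorem det_walkMatrix_blockRowShape (N d e j k : ℕ) (hj : j ≤ N) (hk : k ≤ N) :
    ((walkMatrix (d + e) (fun c : Fin N => (rowShape k).colLen c)
      (fun c => (blockRowShape N d j hj).colLen c)).det : ℝ) =
    ((binomialToeplitz (N + 1) d e).submatrix
      (Fin.succAbove ⟨j, Nat.lt_succ_of_le hj⟩) (Fin.succAbove ⟨k, Nat.lt_succ_of_le hk⟩)).det := by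
  rw [← eq_intCast (Int.castRingHom ℝ), RingHom.map_det, ← Matrix.det_transpose]
  congr 1
  ext i l
  simp only [walkMatrix, binomialToeplitz, RingHom.mapMatrix_apply, Matrix.map_apply,
    Matrix.transpose_apply, Matrix.submatrix_apply, Matrix.of_apply, eq_intCast,
    Int.cast_natCast, colLen_rowShape, colLen_blockRowShape hj i.2]
  congr 2
  have hi : ((Fin.succAbove (⟨j, Nat.lt_succ_of_le hj⟩ : Fin (N + 1)) i : Fin (N + 1)) : ℕ) =
      if (i : ℕ) < j then (i : ℕ) else i + 1 := by
    simp only [Fin.succAbove, Fin.lt_def, Fin.val_castSucc]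
    split_ifs <;> rfl
  have hl : ((Fin.succAbove (⟨k, Nat.lt_succ_of_le hk⟩ : Fin (N + 1)) l : Fin (N + 1)) : ℕ) =
      if (l : ℕ) < k then (l : ℕ) else l + 1 := by
    simp only [Fin.succAbove, Fin.lt_def, Fin.val_castSucc]
    split_ifs <;> rfl
  rw [hi, hl]
  split_ifs <;> push_cast <;> ring

theorem mainTheorem4 (N M d j k : ℕ) (hj : j ≤ N) (hk : k ≤ N)
    (hM : d < M ∨ (d ≤ M ∧ j = 0)) :
    MvPolynomial.eval (fun _ : Fin M => (1 : ℝ))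
        (skewSchur (Fin M) ℝ (blockRowShape N d j hj) (rowShape k)) =
      barnesG ((N : ℝ) + 2) *
        (barnesG ((M : ℝ) + N + 2) / barnesG ((M : ℝ) + 1)) *
        (barnesG ((M : ℝ) - d + 1) / barnesG ((M : ℝ) - d + N + 2)) *
        (barnesG ((d : ℝ) + 1) / barnesG ((d : ℝ) + N + 2)) *
        (Real.Gamma ((M : ℝ) - d + j + 1) / Real.Gamma ((j : ℝ) + 1)) *
        (Real.Gamma ((d : ℝ) + k + 1) / Real.Gamma ((k : ℝ) + 1)) *
        ∑ r ∈ Finset.Icc (max j k) N,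
          Real.Gamma ((r : ℝ) + 1) / Real.Gamma ((M : ℝ) + r + 1) *
            ((Ring.choose ((M : ℤ) - d + r - k - 1) (r - k) : ℤ) : ℝ) *
            ((Ring.choose ((d : ℤ) + r - j - 1) (r - j) : ℤ) : ℝ) := by
  obtain ⟨e, rfl⟩ := Nat.exists_eq_add_of_le (show d ≤ M by omega)
  set jj : Fin (N + 1) := ⟨j, Nat.lt_succ_of_le hj⟩ with hjj
  set kk : Fin (N + 1) := ⟨k, Nat.lt_succ_of_le hk⟩ with hkk
  have hminor : ((binomialToeplitz (N + 1) d e).submatrix jj.succAbove kk.succAbove).det =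
      (-1) ^ (j + k) * (binomialToeplitz (N + 1) d e).adjugate kk jj := by
    rw [Matrix.adjugate_fin_succ_eq_det_submatrix, ← mul_assoc, ← mul_pow]
    simp
  have hGamma : ∀ a b : ℕ, Real.Gamma ((a : ℝ) + b + 1) = ((a + b).factorial : ℝ) := fun a b => by
    rw [← Nat.cast_add, Real.Gamma_nat_eq_factorial]
  have hsum : (-1) ^ (j + k) * ∑ r, toeplitzChoose (N + 1) (-e) r kk *
        (factorialRatio (N + 1) (d + e) r)⁻¹ * toeplitzChoose (N + 1) (-d) r jj =
      ∑ r ∈ Finset.Icc (max j k) N,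
          Real.Gamma ((r : ℝ) + 1) / Real.Gamma (((d + e : ℕ) : ℝ) + r + 1) *
            ((Ring.choose (((d + e : ℕ) : ℤ) - d + r - k - 1) (r - k) : ℤ) : ℝ) *
            ((Ring.choose ((d : ℤ) + r - j - 1) (r - j) : ℤ) : ℝ) := by
    have hsub : Finset.Icc (max j k) N ⊆ Finset.range (N + 1) := fun r hr => by
      rw [Finset.mem_Icc] at hr
      rw [Finset.mem_range]
      omega
    simp only [toeplitzChoose_neg, factorialRatio, hjj, hkk]
    rw [Fin.sum_univ_eq_sum_range (fun r => (if k ≤ r then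
      (-1 : ℝ) ^ (r + k) * ((Ring.choose ((e : ℤ) + r - k - 1) (r - k) : ℤ) : ℝ) else 0) *
      (((d + e + r).factorial : ℝ) / r.factorial)⁻¹ *
      (if j ≤ r then
        (-1 : ℝ) ^ (r + j) * ((Ring.choose ((d : ℤ) + r - j - 1) (r - j) : ℤ) : ℝ) else 0)) (N + 1),
      ← Finset.sum_subset hsub, Finset.mul_sum]
    · refine Finset.sum_congr rfl fun r hr => ?_
      rw [Finset.mem_Icc, max_le_iff] at hr
      rw [if_pos hr.1.1, if_pos hr.1.2, inv_div, hGamma, Real.Gamma_nat_eq_factorial,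
        show ((d + e : ℕ) : ℤ) - d = e by push_cast; ring]
      have hsign : (-1 : ℝ) ^ (j + k) * (-1) ^ (r + k) * (-1) ^ (r + j) = 1 := by
        rw [← pow_add, ← pow_add]
        exact Even.neg_one_pow ⟨j + k + r, by ring⟩
      linear_combination ((r.factorial : ℝ) / (d + e + r).factorial *
        ((Ring.choose ((e : ℤ) + r - k - 1) (r - k) : ℤ) : ℝ) *
        ((Ring.choose ((d : ℤ) + r - j - 1) (r - j) : ℤ) : ℝ)) * hsign
    · intro r hr hr'
      rw [Finset.mem_range] at hr
      rw [Finset.mem_Icc, max_le_iff] at hr'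
      by_cases h : k ≤ r
      · rw [if_neg (show ¬ j ≤ r by omega), mul_zero]
      · rw [if_neg h, zero_mul, zero_mul]
  rw [eval_skewSchur_one_eq_det (d + e) N (rowLen_zero_blockRowShape_le hj)
    (rowLen_zero_rowShape_le hk), det_walkMatrix_blockRowShape N d e j k hj hk, hminor,
    adjugate_binomialToeplitz, ← hsum, det_binomialToeplitz_eq_barnesG,
    show ((d + e : ℕ) : ℝ) - d = e by push_cast; ring, hGamma, hGamma,
    Real.Gamma_nat_eq_factorial, Real.Gamma_nat_eq_factorial]
  simp only [factorialRatio, hjj, hkk]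
  ring
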